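/- Let $R$ be a (not necessarily commutative) left Noetherian ring; modules are left $R$-modules and complexes are indexed homologically by $\mathbb{Z}$. Suprema and infima are taken in $\mathbb{Z}\cup\{\pm\infty\}$, with $\sup\emptyset=-\infty$ and $\inf\emptyset=\infty$. For a complex $X$ put $\inf X=\inf\{i\mid X_i\neq0\}$, $\inf H(X)=\inf\{i\mid H_i(X)\neq 0\}$, $\sup H(X)=\sup\{i\mid H_i(X)\neq0\}$ and $C_n(X)=\operatorname{coker}(\partial_{n+1}\colon X_{n+1}\to X_n)$. Let $D_b^f(R)$ be the class of complexes that are isomorphic in the derived category $D(R)$ to a bounded complex and all of whose homology modules are finitely generated. For complexes $M,N$ and $m\in\mathbb{Z}$ let $\operatorname{Ext}_R^m(M,N)=H_{-m}(\mathbf{R}\mathrm{Hom}_R(M,N))$. If $\inf H(N)\in\mathbb{Z}$, put $$P_R(M,N)=\sup\{n\in\mathbb{Z}\mid \operatorname{Ext}_R^{\,n-\inf H(N)}(M,N)\neq0\},$$ and put $P_R(M,N)=-\infty$ otherwise. For $M\in D_b^f(R)$ let $$B_M^R=\sup\{P_R(M,N)\mid N\in D_b^f(R),\ \inf H(N)\in\mathbb{Z},\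 P_R(M,N)<\infty\}.$$ For a finitely generated module $L$ let $b_L^R$ be the supremum of the numbers $\sup\{n\ge 0\mid\operatorname{Ext}_R^n(L,N)\neq0\}$ over all finitely generated modules $N$ for which this number is less than $\infty$. The ring $R$ has AC if $b_L^R<\infty$ for every finitely generated module $L$. A complex $P$ is semiprojective if every $P_i$ is projective and $\mathrm{Hom}_R(P,-)$ preserves quasi-isomorphisms; a semiprojective resolution of $M$ is a quasi-isomorphism $P\to M$ with $P$ semiprojective. **Proposition.** Let $M\in D_b^f(R)$ be a complex with $P_R(M,R)<\infty$. 1. Let $P\to M$ be a semiprojective resolution with $\inf P=\inf H(M)$ and every $P_i$ finitely generated. If $n\in\mathbb{Z}$ satisfies $n\geq\sup H(M)$, then, with $C=C_n(P)$, $B_M^R<\infty$ if and only if $b_C^R<\infty$. 2. If $R$ has AC, then $B_M^R<\infty$. -/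

import Mathlib

open CategoryTheory Limits

universe u

noncomputable section

namespace AuslanderBound

/- Homological indexing is used throughout: for a cochain complex `M` indexed by `ℤ`, the module in
homological degree `i` is `M.X (-i)`, its differential `∂ᵢ` is `M.d (-i) (-(i - 1))`, and
`Hᵢ(M)` is `M.homology (-i)`. Suprema and infima of sets of integers are taken in the extended
reals, so that `sup ∅ = -∞ = ⊥` and `inf ∅ = ∞ = ⊤`. -/

/-- The inclusion of the integers into the extended reals. -/
def toE (i : ℤ) : EReal := ((i : ℝ) : EReal)

variable {R : Type u} [Ring R]

/-- `inf P = inf {i | Pᵢ ≠ 0}`. -/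
def infDeg (P : CochainComplex (ModuleCat.{u} R) ℤ) : EReal :=
  sInf (toE '' {i : ℤ | Nontrivial (P.X (-i))})

/-- `inf H(M) = inf {i | Hᵢ(M) ≠ 0}`. -/
def infH (M : CochainComplex (ModuleCat.{u} R) ℤ) : EReal :=
  sInf (toE '' {i : ℤ | Nontrivial (M.homology (-i))})

/-- `sup H(M) = sup {i | Hᵢ(M) ≠ 0}`. -/
def supH (M : CochainComplex (ModuleCat.{u} R) ℤ) : EReal :=
  sSup (toE '' {i : ℤ | Nontrivial (M.homology (-i))})

/-- `Cₙ(P) = coker (∂ₙ₊₁ : Pₙ₊₁ → Pₙ)`. -/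
def coker (n : ℤ) (P : CochainComplex (ModuleCat.{u} R) ℤ) : ModuleCat.{u} R :=
  cokernel (P.d (-(n + 1)) (-n))

/-- The morphism of Hom complexes `Hom(P, K) → Hom(P, L)` given by composition with `f : K → L`. -/
def homPostcomp (P : CochainComplex (ModuleCat.{u} R) ℤ)
    {K L : CochainComplex (ModuleCat.{u} R) ℤ} (f : K ⟶ L) :
    CochainComplex.HomComplex P K ⟶ CochainComplex.HomComplex P L where
  f n := AddCommGrpCat.ofHom
    { toFun := fun z => z.comp (CochainComplex.HomComplex.Cochain.ofHom f) (add_zero n)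
      map_zero' := by simp
      map_add' := fun a b => by simp }
  comm' i j _ := by
    ext z
    exact CochainComplex.HomComplex.δ_comp_ofHom z f j

/-- `P` is semiprojective: all its modules are projective and `Hom(P, -)` preserves
quasi-isomorphisms. -/
structure IsSemiprojective (P : CochainComplex (ModuleCat.{u} R) ℤ) : Prop where
  projective (i : ℤ) : Module.Projective R (P.X i)
  quasiIso_hom {K L : CochainComplex (ModuleCat.{u} R) ℤ} (f : K ⟶ L) (hf : QuasiIso f) :
    QuasiIso (homPostcomp P f)

/-- The image of a complex in the derived category `D(R)`. -/
def toD (M : CochainComplex (ModuleCat.{u} R) ℤ) :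
    letI := HasDerivedCategory.standard (ModuleCat.{u} R)
    DerivedCategory (ModuleCat.{u} R) :=
  letI := HasDerivedCategory.standard (ModuleCat.{u} R)
  DerivedCategory.Q.obj M

/-- `M` belongs to `D_b^f(R)`: it is isomorphic in `D(R)` to a bounded complex and all its homology
modules are finitely generated. -/
def IsDbf (M : CochainComplex (ModuleCat.{u} R) ℤ) : Prop :=
  letI := HasDerivedCategory.standard (ModuleCat.{u} R)
  (∃ K : CochainComplex (ModuleCat.{u} R) ℤ,
    (∃ a b : ℤ, K.IsStrictlyGE a ∧ K.IsStrictlyLE b) ∧ Nonempty (toD M ≅ toD K)) ∧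
  ∀ i : ℤ, Module.Finite R (M.homology i)

/-- `Ext_R^m(M, N)` for complexes `M`, `N` and `m ∈ ℤ`: the group of morphisms `M → N[m]` in the
derived category, that is, `H_{-m}(RHom_R(M, N))`. -/
def ExtC (M N : CochainComplex (ModuleCat.{u} R) ℤ) (m : ℤ) : Type (u + 1) :=
  letI := HasDerivedCategory.standard (ModuleCat.{u} R)
  toD M ⟶ (toD N)⟦m⟧

/-- `P_R(M, N) = sup {n ∈ ℤ | Ext_R^{n - inf H(N)}(M, N) ≠ 0}` for complexes `M`, `N` with
`inf H(N)` an integer (and `-∞` if `inf H(N)` is not an integer). -/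
def PC (M N : CochainComplex (ModuleCat.{u} R) ℤ) : EReal :=
  sSup (toE '' {n : ℤ | ∃ k : ℤ, infH N = toE k ∧ Nontrivial (ExtC M N (n - k))})

/-- The Auslander bound of a complex:
`B_M^R = sup {P_R(M, N) | N ∈ D_b^f(R), inf H(N) ∈ ℤ, P_R(M, N) < ∞}`. -/
def complexBound (M : CochainComplex (ModuleCat.{u} R) ℤ) : EReal :=
  sSup {x : EReal | ∃ N : CochainComplex (ModuleCat.{u} R) ℤ,
    IsDbf N ∧ (∃ k : ℤ, infH N = toE k) ∧ PC M N < ⊤ ∧ x = PC M N}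

/-- `P_R(M, N) = sup {n | Ext_R^n(M, N) ≠ 0}` for modules `M`, `N`. -/
def PMod (M N : ModuleCat.{u} R) : EReal :=
  sSup ((fun n : ℕ => toE n) '' {n : ℕ | Nontrivial (Abelian.Ext.{u} M N n)})

/-- The Auslander bound of a module:
`b_M^R = sup {P_R(M, N) | N finitely generated, P_R(M, N) < ∞}`. -/
def moduleBound (M : ModuleCat.{u} R) : EReal :=
  sSup {x : EReal | ∃ N : ModuleCat.{u} R, Module.Finite R N ∧ PMod M N < ⊤ ∧ x = PMod M N}

variable (R) in
/-- `R` has AC: every finitely generated module has finite Auslander bound. -/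
def HasAC : Prop :=
  ∀ M : ModuleCat.{u} R, Module.Finite R M → moduleBound M < ⊤

variable (R) in
/-- The ring `R` as a complex concentrated in degree `0`. -/
def ringComplex : CochainComplex (ModuleCat.{u} R) ℤ :=
  (CochainComplex.singleFunctor (ModuleCat.{u} R) 0).obj (ModuleCat.of R R)

end AuslanderBound

end

/-! ### Vanishing of `Hom(X, Y[m])` under shifts and triangles. -/

namespace AuslanderBound

open DerivedCategory Pretriangulated

universe w

variable {R : Type u} [Ring R] [HasDerivedCategory.{w} (ModuleCat.{u} R)]

/-! Both bounds measure where Ext vanishes, and some modules can be split off a complex without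
disturbing Ext in high degrees. In the second variable these are finite free modules, because
`Ext(M, R)` vanishes above some `p`. In the first variable they are projective modules, when the
target is a module.

Splitting free modules off `N` (`exists_module_of_finite_homology`) leaves one finitely generated
module in the lowest cochain degree. The free modules sit in cochain degrees at most `-inf H(N)`, so
they only affect `Ext^m(M, N)` for `m ≤ p - inf H(N)`. This is exactly the normalization in `P_R(M,
N)`, so a bound over modules gives one over all complexes, whatever their amplitude
(`PC_le_max_of_lt_top`).

If in high degrees `Ext(M, -)` on modules is a shift of `Ext(C, -)` for a module `C`, the bounds of
`M` and `C` are therefore finite together (`complexBound_lt_top_iff`). For part 1, `C = Cₙ(P)`: the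
truncation of `P` is projective above its lowest cochain degree (`homVanishes_iff_coker`). For part
2, the splitting applied to `M` itself yields a finitely generated `C`, to which AC applies. -/

/-- Every morphism `X ⟶ Y⟦m⟧` in the derived category vanishes. -/
def HomVanishes (X Y : DerivedCategory (ModuleCat.{u} R)) (m : ℤ) : Prop :=
  ∀ f : X ⟶ Y⟦m⟧, f = 0

namespace HomVanishes

variable {X X' Y Y' : DerivedCategory (ModuleCat.{u} R)} {m : ℤ}

lemma of_iso_left (e : X ≅ X') (h : HomVanishes X Y m) : HomVanishes X' Y m := fun f => by
  rw [← cancel_epi e.hom, h (e.hom ≫ f), comp_zero]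

lemma of_iso_right (e : Y ≅ Y') (h : HomVanishes X Y m) : HomVanishes X Y' m := fun f => by
  rw [← cancel_mono (e.inv⟦m⟧'), h (f ≫ e.inv⟦m⟧'), zero_comp]

lemma iff_of_iso_left (e : X ≅ X') : HomVanishes X Y m ↔ HomVanishes X' Y m :=
  ⟨of_iso_left e, of_iso_left e.symm⟩

lemma iff_of_iso_right (e : Y ≅ Y') : HomVanishes X Y m ↔ HomVanishes X Y' m :=
  ⟨of_iso_right e, of_iso_right e.symm⟩

lemma iff_subsingleton : HomVanishes X Y m ↔ Subsingleton (X ⟶ Y⟦m⟧) :=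
  ⟨fun h => ⟨fun f g => (h f).trans (h g).symm⟩, fun _ _ => Subsingleton.elim _ _⟩

lemma shift_right_iff {a b : ℤ} (hb : a + m = b) :
    HomVanishes X (Y⟦a⟧) m ↔ HomVanishes X Y b := by
  let e : Y⟦b⟧ ≅ (Y⟦a⟧)⟦m⟧ := (shiftFunctorAdd' _ a m b hb).app Y
  constructor
  · intro h f
    rw [← cancel_mono e.hom, h (f ≫ e.hom), zero_comp]
  · intro h f
    rw [← cancel_mono e.inv, h (f ≫ e.inv), zero_comp]

lemma shift_left_iff {a b : ℤ} (hb : b + a = m) :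
    HomVanishes (X⟦a⟧) Y m ↔ HomVanishes X Y b := by
  let e : Y⟦m⟧ ≅ (Y⟦b⟧)⟦a⟧ := (shiftFunctorAdd' _ b a m hb).app Y
  constructor
  · intro h f
    apply (shiftFunctor (DerivedCategory (ModuleCat.{u} R)) a).map_injective
    rw [← cancel_mono e.inv, h (f⟦a⟧' ≫ e.inv), Functor.map_zero, zero_comp]
  · intro h f
    obtain ⟨g, hg⟩ := (shiftFunctor (DerivedCategory (ModuleCat.{u} R)) a).map_surjective (f ≫ e.hom)
    rw [← cancel_mono e.hom, ← hg, h g, Functor.map_zero, zero_comp]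

lemma single_right_iff (A : ModuleCat.{u} R) {j b : ℤ} (hb : b + j = m) :
    HomVanishes X ((singleFunctor _ j).obj A) m ↔ HomVanishes X ((singleFunctor _ 0).obj A) b := by
  let e : ((singleFunctor _ 0).obj A)⟦-j⟧ ≅ (singleFunctor _ j).obj A :=
    ((singleFunctors (ModuleCat.{u} R)).shiftIso (-j) j 0 (by lia)).app A
  rw [← iff_of_iso_right e]
  exact shift_right_iff (by lia)

lemma single_left_iff (A : ModuleCat.{u} R) {j b : ℤ} (hb : b = m + j) :
    HomVanishes ((singleFunctor _ j).obj A) Y m ↔ HomVanishes ((singleFunctor _ 0).obj A) Y b := by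
  let e : ((singleFunctor _ 0).obj A)⟦-j⟧ ≅ (singleFunctor _ j).obj A :=
    ((singleFunctors (ModuleCat.{u} R)).shiftIso (-j) j 0 (by lia)).app A
  rw [← iff_of_iso_left e]
  exact shift_left_iff (by lia)

lemma single_iff_ext (A B : ModuleCat.{u} R) (n : ℕ) :
    HomVanishes ((singleFunctor _ 0).obj A) ((singleFunctor _ 0).obj B) n ↔
      Subsingleton (Abelian.Ext.{u} A B n) := by
  rw [iff_subsingleton]
  exact (Abelian.Ext.homEquiv (X := A) (Y := B) (n := n)).subsingleton_congr.symm

lemma single_of_projective (F N : ModuleCat.{u} R) [Projective F] {j : ℤ} (h : 0 < m + j) :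
    HomVanishes ((singleFunctor _ j).obj F) ((singleFunctor _ 0).obj N) m := by
  obtain ⟨n, hn⟩ : ∃ n : ℕ, ((n + 1 : ℕ) : ℤ) = m + j := ⟨(m + j - 1).toNat, by lia⟩
  rw [single_left_iff F hn, single_iff_ext]
  exact ⟨fun x y => (Abelian.Ext.eq_zero_of_projective x).trans
    (Abelian.Ext.eq_zero_of_projective y).symm⟩

/-- The identity of `R^k` is a sum of endomorphisms factoring through `R`, so vanishing passes from
`R` to `R^k`. -/
lemma single_free {k : ℕ} {j b : ℤ}
    (h : HomVanishes X ((singleFunctor _ 0).obj (ModuleCat.of R R)) b) (hb : b + j = m) :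
    HomVanishes X ((singleFunctor _ j).obj (ModuleCat.of R (Fin k → R))) m := by
  rw [single_right_iff _ hb]
  intro f
  have hid : 𝟙 (ModuleCat.of R (Fin k → R)) =
      ∑ i : Fin k, ModuleCat.ofHom (LinearMap.proj (R := R) (φ := fun _ : Fin k => R) i) ≫
        ModuleCat.ofHom (LinearMap.single R (fun _ : Fin k => R) i) := by
    ext x i
    simp [ModuleCat.hom_sum]
  have hid' : 𝟙 ((singleFunctor (ModuleCat.{u} R) 0).obj (ModuleCat.of R (Fin k → R))) =
      ∑ i : Fin k, (singleFunctor _ 0).map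
          (ModuleCat.ofHom (LinearMap.proj (R := R) (φ := fun _ : Fin k => R) i)) ≫
        (singleFunctor _ 0).map (ModuleCat.ofHom (LinearMap.single R (fun _ : Fin k => R) i)) := by
    rw [← CategoryTheory.Functor.map_id, hid, Functor.map_sum]
    simp only [Functor.map_comp]
  rw [← Category.comp_id f, ← CategoryTheory.Functor.map_id, hid', Functor.map_sum, Preadditive.comp_sum]
  refine Finset.sum_eq_zero fun i _ => ?_
  rw [Functor.map_comp, ← Category.assoc, h (f ≫ _), zero_comp]

/-- By the long exact sequence of `Hom(W, -)`, the first vertex interferes only in degrees `m` and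
`m + 1`. -/
lemma triangle_right_iff (W : DerivedCategory (ModuleCat.{u} R))
    {T : Triangle (DerivedCategory (ModuleCat.{u} R))} (hT : T ∈ distTriang _)
    (h₀ : HomVanishes W T.obj₁ m) (h₁ : HomVanishes W T.obj₁ (m + 1)) :
    HomVanishes W T.obj₂ m ↔ HomVanishes W T.obj₃ m := by
  have hT' := Triangle.shift_distinguished T hT m
  constructor
  · intro h g
    obtain ⟨f, hf⟩ := Triangle.coyoneda_exact₃ _ hT' g
      ((shift_right_iff (Y := T.obj₁) (a := m) (m := 1) rfl).2 h₁ _)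
    obtain rfl : f = 0 := h f
    exact hf.trans zero_comp
  · intro h f
    obtain ⟨g, hg⟩ := Triangle.coyoneda_exact₂ _ hT' f (h _)
    obtain rfl : g = 0 := h₀ g
    exact hg.trans zero_comp

lemma triangle_left_iff (W : DerivedCategory (ModuleCat.{u} R))
    {T : Triangle (DerivedCategory (ModuleCat.{u} R))} (hT : T ∈ distTriang _)
    (h₀ : HomVanishes T.obj₁ W m) (h₁ : HomVanishes T.obj₁ W (m - 1)) :
    HomVanishes T.obj₂ W m ↔ HomVanishes T.obj₃ W m := by
  constructor
  · intro h g
    obtain ⟨f, hf⟩ := Triangle.yoneda_exact₃ _ hT g (h _)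
    rw [hf, (shift_left_iff (X := T.obj₁) (a := 1) (by lia)).2 h₁ f, comp_zero]
  · intro h f
    obtain ⟨g, hg⟩ := Triangle.yoneda_exact₂ _ hT f (h₀ _)
    rw [hg, h g, comp_zero]

end HomVanishes

end AuslanderBound

/-! ### Dévissage by finite free modules. -/

namespace AuslanderBound

open DerivedCategory Pretriangulated

universe w

lemma finite_of_exact {R : Type u} [Ring R] [IsNoetherianRing R] {S : ShortComplex (ModuleCat.{u} R)} (hS : S.Exact)
    [Module.Finite R S.X₁] [Module.Finite R S.X₃] : Module.Finite R S.X₂ := by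
  have : IsNoetherian R S.X₂ := isNoetherian_of_range_eq_ker S.f.hom S.g.hom
    hS.moduleCat_range_eq_ker
  infer_instance

variable {R : Type u} [Ring R] [HasDerivedCategory.{w} (ModuleCat.{u} R)]

/-- The homology in degree `b` of a module placed in degree `b`. -/
noncomputable def singleHomologyIso (A : ModuleCat.{u} R) (b : ℤ) :
    (homologyFunctor (ModuleCat.{u} R) b).obj ((singleFunctor (ModuleCat.{u} R) b).obj A) ≅ A :=
  (homologyFunctor (ModuleCat.{u} R) b).mapIso ((singleFunctorIsoCompQ _ b).app A) ≪≫
    (homologyFunctorFactors _ b).app _ ≪≫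
      HomologicalComplex.singleObjHomologySelfIso (ComplexShape.up ℤ) b A

lemma finite_homology_single (A : ModuleCat.{u} R) [Module.Finite R A] (b i : ℤ) :
    Module.Finite R ((homologyFunctor (ModuleCat.{u} R) i).obj ((singleFunctor (ModuleCat.{u} R) b).obj A)) := by
  by_cases hi : i = b
  · subst hi
    exact Module.Finite.equiv (singleHomologyIso A i).symm.toLinearEquiv
  · have : IsZero ((homologyFunctor (ModuleCat.{u} R) i).obj ((singleFunctor (ModuleCat.{u} R) b).obj A)) := by
      obtain hi | hi := lt_or_gt_of_ne hi
      · exact isZero_of_isGE _ b i hi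
      · exact isZero_of_isLE _ b i hi
    have := ModuleCat.subsingleton_of_isZero this
    infer_instance

/-- A finitely generated homology module is covered by a finite free module mapping to the object
in the derived category. -/
lemma exists_single_epi_homology (X : DerivedCategory (ModuleCat.{u} R)) (b : ℤ)
    [Module.Finite R ((homologyFunctor (ModuleCat.{u} R) b).obj X)] :
    ∃ (k : ℕ) (f : (singleFunctor (ModuleCat.{u} R) b).obj (ModuleCat.of R (Fin k → R)) ⟶ X),
      Epi ((homologyFunctor (ModuleCat.{u} R) b).map f) := by
  let K : CochainComplex (ModuleCat.{u} R) ℤ := Q.objPreimage X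
  let e : Q.obj K ≅ X := Q.objObjPreimageIso X
  have : Module.Finite R (K.homology b) := Module.Finite.equiv
    ((homologyFunctor (ModuleCat.{u} R) b).mapIso e.symm ≪≫ (homologyFunctorFactors _ b).app K).toLinearEquiv
  obtain ⟨k, p, hp⟩ := Module.Finite.exists_fin' R (K.homology b)
  let F := ModuleCat.of R (Fin k → R)
  have : Projective F := ModuleCat.projective_of_free (Pi.basisFun R (Fin k))
  have hp' : Epi (ModuleCat.ofHom p) := (ModuleCat.epi_iff_surjective _).2 hp
  -- A chain map from a module in degree `b` is a map into the cycles, so the cover of the homology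
  -- is lifted there.
  let q : F ⟶ K.cycles b := Projective.factorThru (ModuleCat.ofHom p) (K.homologyπ b)
  have hq : q ≫ K.homologyπ b = ModuleCat.ofHom p := Projective.factorThru_comp _ _
  let φ : (HomologicalComplex.single _ (ComplexShape.up ℤ) b).obj F ⟶ K :=
    HomologicalComplex.mkHomFromSingle (q ≫ K.iCycles b) (by simp)
  have hφ : (HomologicalComplex.singleObjCyclesSelfIso (ComplexShape.up ℤ) b F).inv ≫
      HomologicalComplex.cyclesMap φ b = q := by
    rw [← cancel_mono (K.iCycles b)]
    simp [φ]
  have hepi : Epi (HomologicalComplex.homologyMap φ b) := by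
    apply epi_of_epi_fac (f := (HomologicalComplex.singleObjCyclesSelfIso
      (ComplexShape.up ℤ) b F).inv ≫ HomologicalComplex.homologyπ _ b) (h := ModuleCat.ofHom p)
    rw [Category.assoc, HomologicalComplex.homologyπ_naturality, reassoc_of% hφ, hq]
  have hepi' : Epi ((homologyFunctor (ModuleCat.{u} R) b).map (Q.map φ)) := by
    rw [(Iso.eq_comp_inv ((homologyFunctorFactors (ModuleCat.{u} R) b).app K)).2
      (homologyFunctorFactors_hom_naturality φ b)]
    exact epi_comp' (epi_comp' inferInstance hepi) inferInstance
  refine ⟨k, (singleFunctorIsoCompQ _ b).hom.app F ≫ Q.map φ ≫ e.hom, ?_⟩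
  rw [Functor.map_comp, Functor.map_comp]
  exact epi_comp' inferInstance (epi_comp' hepi' inferInstance)

/-- The third vertex is the cone of a map from a free module that is onto on `H^b`, which removes
cohomology in degree `b`. The kernel of that surjection may appear in degree `b - 1`, hence `a < b`;
it is finitely generated since `R` is Noetherian. -/
lemma exists_triangle_free [IsNoetherianRing R] (X : DerivedCategory (ModuleCat.{u} R)) (a b : ℤ)
    (hab : a < b) [X.IsGE a] [X.IsLE b] (hX : ∀ i, Module.Finite R ((homologyFunctor (ModuleCat.{u} R) i).obj X)) :
    ∃ (k : ℕ) (T : Triangle (DerivedCategory (ModuleCat.{u} R))), T ∈ distTriang _ ∧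
      T.obj₁ = (singleFunctor (ModuleCat.{u} R) b).obj (ModuleCat.of R (Fin k → R)) ∧ T.obj₂ = X ∧
      T.obj₃.IsGE a ∧ T.obj₃.IsLE (b - 1) ∧
      ∀ i, Module.Finite R ((homologyFunctor (ModuleCat.{u} R) i).obj T.obj₃) := by
  obtain ⟨k, f, hf⟩ := exists_single_epi_homology X b
  obtain ⟨Y, g, h, hT⟩ := distinguished_cocone_triangle f
  refine ⟨k, _, hT, rfl, rfl, ?_, ?_, fun i => ?_⟩
  · rw [isGE_iff]
    intro i hi
    exact (HomologySequence.exact₃ _ hT i (i + 1) rfl).isZero_of_both_zeros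
      ((isZero_of_isGE X a i hi).eq_of_src _ _)
      ((isZero_of_isGE ((singleFunctor (ModuleCat.{u} R) b).obj _) b (i + 1) (by lia)).eq_of_tgt _ _)
  · rw [isLE_iff]
    intro i hi
    refine (HomologySequence.exact₃ _ hT i (i + 1) rfl).isZero_of_both_zeros ?_
      ((isZero_of_isLE ((singleFunctor (ModuleCat.{u} R) b).obj _) b (i + 1) (by lia)).eq_of_tgt _ _)
    obtain rfl | hi' := (show b ≤ i by lia).eq_or_lt
    · exact (HomologySequence.epi_homologyMap_mor₁_iff _ hT b).1 hf
    · exact (isZero_of_isLE X b i hi').eq_of_src _ _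
  · have := finite_homology_single (ModuleCat.of R (Fin k → R)) b (i + 1)
    exact @finite_of_exact _ _ _ _ (HomologySequence.exact₃ _ hT i (i + 1) rfl) (hX i) this

/-- Dévissage of an object with finitely generated bounded homology: up to finite free modules in
higher degrees it is a finitely generated module `C` in the lowest degree. -/
lemma exists_module_of_finite_homology [IsNoetherianRing R] (a b : ℤ) (hab : a ≤ b)
    (X : DerivedCategory (ModuleCat.{u} R)) [X.IsGE a] [X.IsLE b]
    (hX : ∀ i, Module.Finite R ((homologyFunctor (ModuleCat.{u} R) i).obj X)) :
    ∃ C : ModuleCat.{u} R, Module.Finite R C ∧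
      (∀ (W : DerivedCategory (ModuleCat.{u} R)) (p : ℤ),
        (∀ m > p, HomVanishes W ((singleFunctor (ModuleCat.{u} R) 0).obj (ModuleCat.of R R)) m) →
        ∀ m > p + b, (HomVanishes W X m ↔ HomVanishes W ((singleFunctor (ModuleCat.{u} R) a).obj C) m)) ∧
      (∀ (N : ModuleCat.{u} R), ∀ m > -a, (HomVanishes X ((singleFunctor (ModuleCat.{u} R) 0).obj N) m ↔
        HomVanishes ((singleFunctor (ModuleCat.{u} R) a).obj C) ((singleFunctor (ModuleCat.{u} R) 0).obj N) m)) := by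
  induction b, hab using Int.leInduction generalizing X with
  | base =>
    obtain ⟨C, ⟨e⟩⟩ := exists_iso_singleFunctor_obj_of_isGE_of_isLE X a
    have := hX a
    exact ⟨C, Module.Finite.equiv
      ((homologyFunctor (ModuleCat.{u} R) a).mapIso e ≪≫ singleHomologyIso C a).toLinearEquiv,
      fun W p _ m _ => HomVanishes.iff_of_iso_right e,
      fun N m _ => HomVanishes.iff_of_iso_left e⟩
  | succ b hab ih =>
    obtain ⟨k, T, hT, h₁, rfl, hGE, hLE, hfin⟩ := exists_triangle_free X a (b + 1) (by lia) hX
    rw [add_sub_cancel_right] at hLE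
    obtain ⟨C, hC, hr, hl⟩ := ih T.obj₃ hfin
    refine ⟨C, hC, fun W p hW m hm => ?_, fun N m hm => ?_⟩
    -- For `m > p + b + 1`, both `m - (b + 1)` and `m + 1 - (b + 1)` exceed `p`.
    · rw [← hr W p hW m (by lia)]
      refine HomVanishes.triangle_right_iff W hT ?_ ?_ <;> rw [h₁]
      · exact HomVanishes.single_free (hW (m - (b + 1)) (by lia)) (by lia)
      · exact HomVanishes.single_free (hW (m + 1 - (b + 1)) (by lia)) (by lia)
    · rw [← hl N m hm]
      have : Projective (ModuleCat.of R (Fin k → R)) :=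
        ModuleCat.projective_of_free (Pi.basisFun R (Fin k))
      refine HomVanishes.triangle_left_iff _ hT ?_ ?_ <;> rw [h₁]
      · exact HomVanishes.single_of_projective _ _ (by lia)
      · exact HomVanishes.single_of_projective _ _ (by lia)

end AuslanderBound

/-! ### Removing projectives from a bounded complex. -/

namespace AuslanderBound

open DerivedCategory Pretriangulated

universe w

variable {R : Type u} [Ring R] [HasDerivedCategory.{w} (ModuleCat.{u} R)]

/-- A bounded complex which is projective above its lowest degree `c` has the same Ext groups in
degrees `> -c` as the module in degree `c`. -/
lemma homVanishes_of_projective_above (c d : ℤ) (hcd : c ≤ d)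
    (T : CochainComplex (ModuleCat.{u} R) ℤ) [T.IsStrictlyGE c] [T.IsStrictlyLE d]
    (hT : ∀ j > c, Projective (T.X j)) (N : ModuleCat.{u} R) (m : ℤ) (hm : m > -c) :
    HomVanishes (Q.obj T) ((singleFunctor (ModuleCat.{u} R) 0).obj N) m ↔
      HomVanishes ((singleFunctor (ModuleCat.{u} R) c).obj (T.X c)) ((singleFunctor (ModuleCat.{u} R) 0).obj N) m := by
  induction d, hcd using Int.leInduction generalizing T with
  | base =>
    obtain ⟨A, ⟨e⟩⟩ := T.exists_iso_single c
    let e' : A ≅ T.X c := (HomologicalComplex.singleObjXSelf (ComplexShape.up ℤ) c A).symm ≪≫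
      (HomologicalComplex.eval _ _ c).mapIso e.symm
    exact HomVanishes.iff_of_iso_left (Q.mapIso e ≪≫ (singleFunctorIsoCompQ _ c).symm.app A ≪≫
      (singleFunctor (ModuleCat.{u} R) c).mapIso e')
  | succ d hcd ih =>
    -- The differential out of the top degree is zero, so the top module is a subcomplex; the
    -- quotient agrees with `T` in every other degree.
    let ι : (HomologicalComplex.single _ (ComplexShape.up ℤ) (d + 1)).obj (T.X (d + 1)) ⟶ T :=
      HomologicalComplex.mkHomFromSingle (𝟙 _)
        (fun k hk => (T.isZero_of_isStrictlyLE (d + 1) k (by simp at hk; lia)).eq_of_tgt _ _)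
    have hι : IsIso (ι.f (d + 1)) := by
      simp only [ι, HomologicalComplex.mkHomFromSingle_f]
      infer_instance
    have : Mono ι := by
      have (i : ℤ) : Mono (ι.f i) := by
        by_cases hi : i = d + 1
        · subst hi; infer_instance
        · exact (HomologicalComplex.isZero_single_obj_X (ComplexShape.up ℤ) _ _ _ hi).mono _
      exact HomologicalComplex.mono_of_mono_f ι this
    let S : ShortComplex (CochainComplex (ModuleCat.{u} R) ℤ) :=
      ShortComplex.mk ι (cokernel.π ι) (cokernel.condition ι)
    have hS : S.ShortExact := { exact := ShortComplex.exact_cokernel ι }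
    have hSi (i : ℤ) : (S.map (HomologicalComplex.eval _ (ComplexShape.up ℤ) i)).ShortExact :=
      hS.map_of_exact _
    have htop : IsZero (S.X₃.X (d + 1)) := (hSi (d + 1)).isIso_f_iff.1 hι
    have hiso (i : ℤ) (hi : i ≠ d + 1) : IsIso (S.g.f i) :=
      (hSi i).isIso_g_iff.2 (HomologicalComplex.isZero_single_obj_X (ComplexShape.up ℤ) _ _ _ hi)
    have : S.X₃.IsStrictlyGE c := by
      rw [CochainComplex.isStrictlyGE_iff]
      intro i hi
      have := hiso i (by lia)
      exact (T.isZero_of_isStrictlyGE c i hi).of_iso (asIso (S.g.f i)).symm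
    have : S.X₃.IsStrictlyLE d := by
      rw [CochainComplex.isStrictlyLE_iff]
      intro i hi
      by_cases hi' : i = d + 1
      · exact hi' ▸ htop
      · have := hiso i hi'
        exact (T.isZero_of_isStrictlyLE (d + 1) i (by lia)).of_iso (asIso (S.g.f i)).symm
    have hproj (j : ℤ) (hj : j > c) : Projective (S.X₃.X j) := by
      by_cases hj' : j = d + 1
      · exact hj' ▸ htop.projective
      · have := hiso j hj'
        exact Projective.of_iso (asIso (S.g.f j)) (hT j hj)
    have := hiso c (by lia)
    have htri := triangleOfSES_distinguished hS
    have := hT (d + 1) (by lia)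
    have hfirst (r : ℤ) (hr : 0 < r + (d + 1)) :
        HomVanishes (Q.obj S.X₁) ((singleFunctor (ModuleCat.{u} R) 0).obj N) r :=
      HomVanishes.of_iso_left ((singleFunctorIsoCompQ _ (d + 1)).app (T.X (d + 1)))
        (HomVanishes.single_of_projective _ _ hr)
    rw [HomVanishes.iff_of_iso_left ((singleFunctor (ModuleCat.{u} R) c).mapIso (asIso (S.g.f c))),
      ← ih S.X₃ hproj]
    exact HomVanishes.triangle_left_iff _ htri (hfirst _ (by lia)) (hfirst _ (by lia))

end AuslanderBound

/-! ### Translating the suprema into vanishing, and comparing the bounds. -/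

namespace AuslanderBound

open DerivedCategory Pretriangulated

lemma toE_le_toE {i j : ℤ} : toE i ≤ toE j ↔ i ≤ j := by simp [toE]

/-- Integer upper bounds treat finite suprema and `-∞` uniformly. -/
lemma lt_top_iff_exists_le_toE (x : EReal) : x < ⊤ ↔ ∃ p : ℤ, x ≤ toE p := by
  constructor
  · intro h
    obtain ⟨r, hr, -⟩ := EReal.lt_iff_exists_real_btwn.1 h
    exact ⟨⌈r⌉, hr.le.trans (EReal.coe_le_coe_iff.2 (Int.le_ceil r))⟩
  · rintro ⟨p, hp⟩
    exact hp.trans_lt (EReal.coe_lt_top _)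

variable {R : Type u} [Ring R]

attribute [local instance] HasDerivedCategory.standard

lemma not_nontrivial_extC_iff (M N : CochainComplex (ModuleCat.{u} R) ℤ) (m : ℤ) :
    ¬ Nontrivial (ExtC M N m) ↔ HomVanishes (Q.obj M) (Q.obj N) m := by
  rw [not_nontrivial_iff_subsingleton, HomVanishes.iff_subsingleton]
  rfl

lemma PC_le_iff (M : CochainComplex (ModuleCat.{u} R) ℤ) {N : CochainComplex (ModuleCat.{u} R) ℤ}
    {k : ℤ} (hN : infH N = toE k) (p : ℤ) :
    PC M N ≤ toE p ↔ ∀ m > p - k, HomVanishes (Q.obj M) (Q.obj N) m := by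
  rw [PC, sSup_le_iff, Set.forall_mem_image]
  simp only [← not_nontrivial_extC_iff, toE_le_toE, Set.mem_ofPred_eq]
  constructor
  · intro h m hm hnt
    have := h (x := m + k) ⟨k, hN, by simpa using hnt⟩
    lia
  · rintro h n ⟨k', hk', hnt⟩
    obtain rfl : k = k' := by
      rw [hN] at hk'
      exact le_antisymm (toE_le_toE.1 hk'.le) (toE_le_toE.1 hk'.ge)
    by_contra hn
    exact h (n - k) (by lia) hnt

lemma PMod_le_iff (C K : ModuleCat.{u} R) (p : ℤ) :
    PMod C K ≤ toE p ↔ ∀ n : ℕ, p < n →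
      HomVanishes ((singleFunctor (ModuleCat.{u} R) 0).obj C)
        ((singleFunctor (ModuleCat.{u} R) 0).obj K) n := by
  rw [PMod, sSup_le_iff, Set.forall_mem_image]
  simp only [HomVanishes.single_iff_ext, ← not_nontrivial_iff_subsingleton, toE_le_toE,
    Set.mem_ofPred_eq]
  exact forall_congr' fun n => ⟨fun h h₁ h₂ => by have := h h₂; lia,
    fun h h₁ => by by_contra h₂; exact h (by lia) h₁⟩

lemma HomVanishes.single_of_subsingleton (X : DerivedCategory (ModuleCat.{u} R))
    (A : ModuleCat.{u} R) [Subsingleton A] (m : ℤ) :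
    HomVanishes X ((singleFunctor (ModuleCat.{u} R) 0).obj A) m := fun _ =>
  ((shiftFunctor _ m).map_isZero ((singleFunctor (ModuleCat.{u} R) 0).map_isZero
    (ModuleCat.isZero_of_subsingleton A))).eq_of_tgt _ _

lemma infH_single (A : ModuleCat.{u} R) [Nontrivial A] :
    infH ((CochainComplex.singleFunctor (ModuleCat.{u} R) 0).obj A) = toE 0 := by
  have h : {i : ℤ | Nontrivial (((CochainComplex.singleFunctor (ModuleCat.{u} R) 0).obj A).homology
      (-i))} = {0} := by
    ext i
    simp only [Set.mem_ofPred_eq, Set.mem_singleton_iff]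
    constructor
    · intro h
      by_contra hi
      have := ModuleCat.subsingleton_of_isZero (HomologicalComplex.isZero_single_obj_homology
        (ComplexShape.up ℤ) 0 A (-i) (by lia))
      exact not_nontrivial_iff_subsingleton.2 this h
    · rintro rfl
      exact (HomologicalComplex.singleObjHomologySelfIso
        (ComplexShape.up ℤ) 0 A).toLinearEquiv.toEquiv.nontrivial
  rw [infH, h, Set.image_singleton, sInf_singleton]

lemma homology_iso (N : CochainComplex (ModuleCat.{u} R) ℤ) (i : ℤ) :
    Nonempty ((homologyFunctor (ModuleCat.{u} R) i).obj (Q.obj N) ≅ N.homology i) :=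
  ⟨(homologyFunctorFactors (ModuleCat.{u} R) i).app N⟩

lemma PC_le_of_complexBound_le {M N : CochainComplex (ModuleCat.{u} R) ℤ} {B : EReal}
    (hB : complexBound M ≤ B) (hN : IsDbf N) {k : ℤ} (hk : infH N = toE k) (h : PC M N < ⊤) :
    PC M N ≤ B :=
  le_trans (le_sSup (show PC M N ∈ {x : EReal | ∃ N : CochainComplex (ModuleCat.{u} R) ℤ,
    IsDbf N ∧ (∃ k : ℤ, infH N = toE k) ∧ PC M N < ⊤ ∧ x = PC M N} from
      ⟨N, hN, ⟨k, hk⟩, h, rfl⟩)) hB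

lemma PMod_le_of_moduleBound_le {C K : ModuleCat.{u} R} {b : EReal} (hb : moduleBound C ≤ b)
    (hK : Module.Finite R K) (h : PMod C K < ⊤) : PMod C K ≤ b :=
  le_trans (le_sSup (show PMod C K ∈ {x : EReal | ∃ N : ModuleCat.{u} R,
    Module.Finite R N ∧ PMod C N < ⊤ ∧ x = PMod C N} from ⟨K, hK, h, rfl⟩)) hb

lemma isDbf_single (A : ModuleCat.{u} R) [Module.Finite R A] :
    IsDbf ((CochainComplex.singleFunctor (ModuleCat.{u} R) 0).obj A) := by
  refine ⟨⟨_, ⟨0, 0, inferInstance, inferInstance⟩, ⟨Iso.refl _⟩⟩, fun i => ?_⟩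
  obtain ⟨e⟩ := homology_iso ((CochainComplex.singleFunctor (ModuleCat.{u} R) 0).obj A) i
  have : Module.Finite R ((homologyFunctor (ModuleCat.{u} R) i).obj
    (Q.obj ((CochainComplex.singleFunctor (ModuleCat.{u} R) 0).obj A))) :=
    finite_homology_single A 0 i
  exact Module.Finite.equiv e.toLinearEquiv

lemma homVanishes_single_of_PC_le {M : CochainComplex (ModuleCat.{u} R) ℤ} {A : ModuleCat.{u} R}
    {p : ℤ} (h : PC M ((CochainComplex.singleFunctor (ModuleCat.{u} R) 0).obj A) ≤ toE p)
    {m : ℤ} (hm : m > p) :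
    HomVanishes (Q.obj M) ((singleFunctor (ModuleCat.{u} R) 0).obj A) m := by
  -- The zero module has `inf H = ∞`, so its `PC` carries no information and it is handled directly.
  cases subsingleton_or_nontrivial A
  · exact HomVanishes.single_of_subsingleton _ A m
  · exact (PC_le_iff M (infH_single A) p).1 h m (by lia)

lemma subsingleton_homology_of_lt_infH {N : CochainComplex (ModuleCat.{u} R) ℤ} {k i : ℤ}
    (hN : toE k ≤ infH N) (hi : -k < i) : Subsingleton (N.homology i) := by
  rw [← not_nontrivial_iff_subsingleton]
  intro h
  have := toE_le_toE.1 (hN.trans (sInf_le (Set.mem_image_of_mem toE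
    (show Nontrivial (N.homology (- -i)) by rwa [neg_neg]))))
  lia

lemma isLE_of_le_infH {N : CochainComplex (ModuleCat.{u} R) ℤ} {k : ℤ} (hN : toE k ≤ infH N) :
    (Q.obj N).IsLE (-k) := by
  rw [isLE_iff]
  intro i hi
  have := subsingleton_homology_of_lt_infH hN hi
  obtain ⟨e⟩ := homology_iso N i
  exact (ModuleCat.isZero_of_subsingleton (N.homology i)).of_iso e

lemma isGE_of_supH_le {N : CochainComplex (ModuleCat.{u} R) ℤ} {n : ℤ} (hN : supH N ≤ toE n) :
    (Q.obj N).IsGE (-n) := by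
  rw [isGE_iff]
  intro i hi
  have : Subsingleton (N.homology i) := by
    rw [← not_nontrivial_iff_subsingleton]
    intro h
    have := toE_le_toE.1 ((le_sSup (Set.mem_image_of_mem toE
      (show Nontrivial (N.homology (- -i)) by rwa [neg_neg]))).trans hN)
    lia
  obtain ⟨e⟩ := homology_iso N i
  exact (ModuleCat.isZero_of_subsingleton (N.homology i)).of_iso e

lemma le_infH_of_isLE {N : CochainComplex (ModuleCat.{u} R) ℤ} {b : ℤ} [(Q.obj N).IsLE b] :
    toE (-b) ≤ infH N := by
  rw [infH, le_sInf_iff, Set.forall_mem_image]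
  intro i hi
  rw [toE_le_toE]
  by_contra h
  obtain ⟨e⟩ := homology_iso N (-i)
  have := ModuleCat.subsingleton_of_isZero
    ((isZero_of_isLE (Q.obj N) b (-i) (by lia)).of_iso e.symm)
  exact not_nontrivial_iff_subsingleton.2 this hi

lemma IsDbf.finite_homology {N : CochainComplex (ModuleCat.{u} R) ℤ} (hN : IsDbf N) (i : ℤ) :
    Module.Finite R ((homologyFunctor (ModuleCat.{u} R) i).obj (Q.obj N)) := by
  obtain ⟨e⟩ := homology_iso N i
  have := hN.2 i
  exact Module.Finite.equiv e.symm.toLinearEquiv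

lemma IsDbf.exists_bounds {N : CochainComplex (ModuleCat.{u} R) ℤ} (hN : IsDbf N) :
    ∃ a b : ℤ, (Q.obj N).IsGE a ∧ (Q.obj N).IsLE b := by
  obtain ⟨⟨K, ⟨a, b, _, _⟩, ⟨e⟩⟩, -⟩ := hN
  let e' : Q.obj N ≅ Q.obj K := e
  exact ⟨a, b, TStructure.t.isGE_of_iso e'.symm a, TStructure.t.isLE_of_iso e'.symm b⟩

/-- If every finitely generated module eventually killed by `Ext(M, -)` is killed in degrees
`> q`, then complexes eventually killed by `Ext(M, -)` are killed in degrees above a uniform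
bound. -/
lemma PC_le_max_of_lt_top [IsNoetherianRing R] {M N : CochainComplex (ModuleCat.{u} R) ℤ} {p q : ℤ}
    (hp : ∀ m > p, HomVanishes (Q.obj M)
      ((singleFunctor (ModuleCat.{u} R) 0).obj (ModuleCat.of R R)) m)
    (hq : ∀ K : ModuleCat.{u} R, Module.Finite R K →
      (∃ r, ∀ m > r, HomVanishes (Q.obj M) ((singleFunctor (ModuleCat.{u} R) 0).obj K) m) →
      ∀ m > q, HomVanishes (Q.obj M) ((singleFunctor (ModuleCat.{u} R) 0).obj K) m)
    (hN : IsDbf N) {k : ℤ} (hk : infH N = toE k) (hlt : PC M N < ⊤) :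
    PC M N ≤ toE (max p q) := by
  obtain ⟨a, -, _, -⟩ := hN.exists_bounds
  obtain ⟨s, hs⟩ := (lt_top_iff_exists_le_toE _).1 hlt
  rw [PC_le_iff M hk] at hs ⊢
  -- The minimum guarantees `c ≤ -k`, as the dévissage requires.
  let c := min a (-k)
  have := isLE_of_le_infH hk.ge
  have : (Q.obj N).IsGE c := TStructure.t.isGE_of_ge _ c a (min_le_left _ _)
  obtain ⟨C, hC, hr, -⟩ := exists_module_of_finite_homology c (-k) (min_le_right _ _) (Q.obj N)
    hN.finite_homology
  have key (m : ℤ) (hm : m > p - k) : HomVanishes (Q.obj M) (Q.obj N) m ↔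
      HomVanishes (Q.obj M) ((singleFunctor (ModuleCat.{u} R) 0).obj C) (m - c) :=
    (hr (Q.obj M) p hp m (by lia)).trans (HomVanishes.single_right_iff C (by lia))
  have hC' := hq C hC ⟨max s p - k - c, fun m hm => by
    have := (key (m + c) (by lia)).1 (hs _ (by lia))
    rwa [add_sub_cancel_right] at this⟩
  -- From `m > q - k` and `c ≤ -k` follows `m - c > q`.
  exact fun m hm => (key m (by lia)).2 (hC' _ (by lia))

/-- If the Ext groups of `M` into finitely generated modules agree in degrees `> n` with those of
a module `C` placed in homological degree `n`, the Auslander bounds of `M` and `C` are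
simultaneously finite. -/
lemma complexBound_lt_top_iff [IsNoetherianRing R] {M : CochainComplex (ModuleCat.{u} R) ℤ}
    (hMR : PC M (ringComplex R) < ⊤) (C : ModuleCat.{u} R) (n : ℤ)
    (hC : ∀ N : ModuleCat.{u} R, ∀ m > n,
      (HomVanishes (Q.obj M) ((singleFunctor (ModuleCat.{u} R) 0).obj N) m ↔
        HomVanishes ((singleFunctor (ModuleCat.{u} R) (-n)).obj C)
          ((singleFunctor (ModuleCat.{u} R) 0).obj N) m)) :
    complexBound M < ⊤ ↔ moduleBound C < ⊤ := by
  replace hC (N : ModuleCat.{u} R) (m : ℤ) (hm : m > n) :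
      HomVanishes (Q.obj M) ((singleFunctor (ModuleCat.{u} R) 0).obj N) m ↔
        HomVanishes ((singleFunctor (ModuleCat.{u} R) 0).obj C)
          ((singleFunctor (ModuleCat.{u} R) 0).obj N) ((m - n).toNat : ℤ) :=
    (hC N m hm).trans (HomVanishes.single_left_iff C (by lia))
  simp only [lt_top_iff_exists_le_toE (complexBound M), lt_top_iff_exists_le_toE (moduleBound C)]
  constructor
  · rintro ⟨B, hB⟩
    -- `Ext^i(C, -)` corresponds to `Ext^(i + n)(M, -)` only for `i > 0`, whence the `0`.
    refine ⟨max 0 (B - n), sSup_le ?_⟩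
    rintro _ ⟨K, hK, hlt, rfl⟩
    obtain ⟨r, hr⟩ := (lt_top_iff_exists_le_toE _).1 hlt
    rw [PMod_le_iff] at hr ⊢
    cases subsingleton_or_nontrivial K
    · exact fun i _ => HomVanishes.single_of_subsingleton _ K i
    · have hle : PC M ((CochainComplex.singleFunctor (ModuleCat.{u} R) 0).obj K) ≤
          toE (max n (r + n)) :=
        (PC_le_iff M (infH_single K) _).2 fun m hm => (hC K m (by lia)).2 (hr _ (by lia))
      have hle' : PC M ((CochainComplex.singleFunctor (ModuleCat.{u} R) 0).obj K) ≤ toE B :=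
        PC_le_of_complexBound_le hB (isDbf_single K) (infH_single K)
          ((lt_top_iff_exists_le_toE _).2 ⟨_, hle⟩)
      intro i hi
      have := (hC K (i + n) (by lia)).1 (homVanishes_single_of_PC_le hle' (by lia))
      rwa [add_sub_cancel_right, Int.toNat_natCast] at this
  · rintro ⟨b, hb⟩
    obtain ⟨p, hp⟩ := (lt_top_iff_exists_le_toE _).1 hMR
    -- `p` comes from `Ext(M, R)`; the other term bounds the Ext into modules, `max b 0` keeping the
    -- degree above `n`, where the comparison with `C` holds.
    refine ⟨max p (n + max b 0), sSup_le ?_⟩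
    rintro _ ⟨N, hN, ⟨k, hk⟩, hlt, rfl⟩
    refine PC_le_max_of_lt_top (fun m hm => homVanishes_single_of_PC_le hp hm) ?_ hN hk hlt
    rintro K hK ⟨r, hr⟩ m hm
    have hle : PMod C K ≤ toE (max r n - n) := (PMod_le_iff C K _).2 fun i hi => by
      by_cases hi0 : i = 0
      · lia
      · have := (hC K (i + n) (by lia)).1 (hr _ (by lia))
        rwa [add_sub_cancel_right, Int.toNat_natCast] at this
    have hle' : PMod C K ≤ toE b :=
      PMod_le_of_moduleBound_le hb hK ((lt_top_iff_exists_le_toE _).2 ⟨_, hle⟩)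
    exact (hC K m (by lia)).2 ((PMod_le_iff C K b).1 hle' _ (by lia))

/-- The lowest module of the truncation of `P` in cochain degrees `≥ -n` is `Cₙ(P)`. -/
noncomputable def truncGEIsoCoker (P : CochainComplex (ModuleCat.{u} R) ℤ) (n : ℤ) :
    (P.truncGE (-n)).X (-n) ≅ coker n P :=
  P.truncGEXIsoOpcycles (-n) ≪≫
    (P.opcyclesIsCokernel (-(n + 1)) (-n) (by simp; lia)).coconePointUniqueUpToIso
      (colimit.isColimit _)

lemma isStrictlyLE_of_le_infDeg {P : CochainComplex (ModuleCat.{u} R) ℤ} {k : ℤ}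
    (hP : toE k ≤ infDeg P) : P.IsStrictlyLE (-k) := by
  rw [CochainComplex.isStrictlyLE_iff]
  intro i hi
  have : Subsingleton (P.X i) := by
    rw [← not_nontrivial_iff_subsingleton]
    intro h
    have := toE_le_toE.1 (hP.trans (sInf_le (Set.mem_image_of_mem toE
      (show Nontrivial (P.X (- -i)) by rwa [neg_neg]))))
    lia
  exact ModuleCat.isZero_of_subsingleton _

/-- A complex with a degreewise projective bounded below resolution `P` has the same Ext groups in
degrees `> n` as the module `Cₙ(P)` placed in homological degree `n`. -/
lemma homVanishes_iff_coker {M P : CochainComplex (ModuleCat.{u} R) ℤ} (π : P ⟶ M) [QuasiIso π]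
    (hproj : ∀ i, Projective (P.X i)) {k n : ℤ} (hk : toE k ≤ infDeg P) (hn : supH M ≤ toE n)
    (N : ModuleCat.{u} R) (m : ℤ) (hm : m > n) :
    HomVanishes (Q.obj M) ((singleFunctor (ModuleCat.{u} R) 0).obj N) m ↔
      HomVanishes ((singleFunctor (ModuleCat.{u} R) (-n)).obj (coker n P))
        ((singleFunctor (ModuleCat.{u} R) 0).obj N) m := by
  have := isStrictlyLE_of_le_infDeg hk
  have := isGE_of_supH_le hn
  have : P.IsGE (-n) := by
    rw [← isGE_Q_obj_iff]
    exact TStructure.t.isGE_of_iso (asIso (Q.map π)).symm (-n)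
  -- `n` may lie below the lower bound `k` of `P`; the maximum keeps the upper end at least `-n`.
  have : (P.truncGE (-n)).IsStrictlyLE (max (-k) (-n)) := by
    rw [CochainComplex.isStrictlyLE_iff]
    intro i hi
    exact (P.isZero_of_isStrictlyLE (-k) i (by lia)).of_iso (P.truncGEXIso (-n) i (by lia))
  rw [← HomVanishes.iff_of_iso_left (asIso (Q.map π)),
    HomVanishes.iff_of_iso_left (asIso (Q.map (P.πTruncGE (-n)))),
    homVanishes_of_projective_above (-n) (max (-k) (-n)) (le_max_right _ _) _
      (fun j hj => Projective.of_iso (P.truncGEXIso (-n) j hj).symm (hproj j)) N m (by lia)]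
  exact HomVanishes.iff_of_iso_left ((singleFunctor _ (-n)).mapIso (truncGEIsoCoker P n))

end AuslanderBound

open AuslanderBound

theorem proposition3p6 {R : Type u} [Ring R] [IsNoetherianRing R]
    (M : CochainComplex (ModuleCat.{u} R) ℤ) (hM : AuslanderBound.IsDbf M)
    (hMR : AuslanderBound.PC M (AuslanderBound.ringComplex R) < ⊤) :
    (∀ (P : CochainComplex (ModuleCat.{u} R) ℤ) (π : P ⟶ M),
      AuslanderBound.IsSemiprojective P → QuasiIso π →
      (∀ i : ℤ, Module.Finite R (P.X i)) →
      AuslanderBound.infDeg P = AuslanderBound.infH M →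
      ∀ n : ℤ, AuslanderBound.supH M ≤ AuslanderBound.toE n →
        (AuslanderBound.complexBound M < ⊤ ↔ AuslanderBound.moduleBound (AuslanderBound.coker n P) < ⊤)) ∧
    (AuslanderBound.HasAC R → AuslanderBound.complexBound M < ⊤) := by
  let := HasDerivedCategory.standard (ModuleCat.{u} R)
  obtain ⟨a, b, _, _⟩ := hM.exists_bounds
  refine ⟨fun P π hP hπ _ hinf n hn => ?_, fun hAC => ?_⟩
  · refine complexBound_lt_top_iff hMR _ n fun N m hm => ?_
    exact homVanishes_iff_coker π
      (fun i => (IsProjective.iff_projective (P.X i)).1 (hP.projective i))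
      -- The integer bound `-b` remains available when `M` is acyclic and `inf H(M) = ∞`.
      (hinf ▸ le_infH_of_isLE (b := b)) hn N m hm
  · have : (DerivedCategory.Q.obj M).IsGE (min a b) :=
      DerivedCategory.TStructure.t.isGE_of_ge _ _ a (min_le_left _ _)
    obtain ⟨C, hC, -, hl⟩ := exists_module_of_finite_homology (min a b) b (min_le_right _ _)
      (DerivedCategory.Q.obj M) hM.finite_homology
    refine (complexBound_lt_top_iff hMR C (-(min a b)) fun N m hm => ?_).2 (hAC C hC)
    rw [neg_neg]
    exact hl N m hm
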